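/- Let $\mathbb K$ be a field of characteristic $0$, let $\ell\ge 1$, and let $G\subseteq K_\ell:=\{(i,j)\mid 1\le i<j\le \ell\}$ be a subgraph of the complete graph on $\{1,\dots,\ell\}$, regarded as a set of directed edges. Let $x_1,\dots,x_\ell$ be the coordinates of $\mathbb K^\ell$, and let $$\mathrm{Ish}_G:=\{\{x_i-x_j=0\}\mid 1\le i<j\le \ell\}\cup\{\{x_1-x_j=i\}\mid (i,j)\in G\}$$ be the deleted Ish arrangement. Its cone $\mathbf c(\mathrm{Ish}_G)$ is the central arrangement in $\mathbb K^{\ell+1}$, with coordinates $x_1,\dots,x_\ell,z$, consisting of $\{z=0\}$, the hyperplanes $\{x_i-x_j=0\}$ for $1\le i<j\le \ell$, and the hyperplanes $\{x_1-x_j-iz=0\}$ for $(i,j)\in G$. A central arrangement $\mathcal A$ in $\mathbb K^{\ell+1}$ is called free if its module of logarithmic derivations $$D(\mathcal A)=\{\theta\in\mathrm{Der}_{\mathbb K}(S)\mid \theta(\alpha_H)\in\alpha_H S\text{ for all }H\in\mathcal A\},\qquad S=\mathbb K[x_1,\dots,x_\ell,z],\quad H=\ker\alpha_H,$$ is a free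 $S$-module. For $2\le j\le \ell$ put $N_j:=\{0\}\cup\{i\mid (i,j)\in G\}\subseteq\mathbb K$, and let $N_G=(N_2,\dots,N_\ell)$. Then the following are equivalent: 1. $\mathbf c(\mathrm{Ish}_G)$ is free. 2. $N_G$ is a nest, that is, there is a permutation $w$ of $\{2,\dots,\ell\}$ such that $N_{w(2)}\subseteq N_{w(3)}\subseteq\dots\subseteq N_{w(\ell)}$. 3. (Athanasiadis' condition) There is a permutation $w$ of $\{1,\dots,\ell\}$ such that the set $w^{-1}G:=\{(w^{-1}(i),w^{-1}(j))\mid (i,j)\in G\}$ is contained in $K_\ell$ and, whenever $1\le i<j<k\le \ell$ and $(i,j)\in w^{-1}G$, also $(i,k)\in w^{-1}G$. 4. For any $j,k\in\{2,\dots,\ell\}$, at least one of the following holds: (i) for every $i\in\{1,\dots,\ell\}$, if $(i,j)\in G$ then $(i,k)\in G$; (ii) for every $i\in\{1,\dots,\ell\}$, if $(i,k)\in G$ then $(i,j)\in G$. -/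

import Mathlib

namespace DeletedIsh

section Arrangements

/-- The linear form `α` on `K^σ`, regarded as the homogeneous polynomial
`∑ i, α(e_i) X_i` of degree one in the coordinate ring `S = K[X_i : i ∈ σ]`. -/
noncomputable def linearFormPoly {K σ : Type*} [Field K] [Fintype σ] [DecidableEq σ]
    (α : Module.Dual K (σ → K)) : MvPolynomial σ K :=
  ∑ i, MvPolynomial.C (α (Pi.single i 1)) * MvPolynomial.X i

/-- The module `D(A)` of logarithmic derivations of a central arrangement `A` (a set of linear
hyperplanes of `K^σ`): the derivations `θ` of `S` over `K` such that `θ(α) ∈ α S` for every `H ∈ A`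
and every linear form `α` with kernel `H`. (For a hyperplane `H`, such an `α` is unique up to
a nonzero scalar.) -/
noncomputable def logDerivations {K σ : Type*} [Field K] [Fintype σ] [DecidableEq σ]
    (A : Set (Submodule K (σ → K))) :
    Submodule (MvPolynomial σ K)
      (Derivation K (MvPolynomial σ K) (MvPolynomial σ K)) where
  carrier := {θ | ∀ H ∈ A, ∀ α : Module.Dual K (σ → K), LinearMap.ker α = H →
    linearFormPoly α ∣ θ (linearFormPoly α)}
  add_mem' := by
    intro θ η hθ hη H hH α hα
    simpa using dvd_add (hθ H hH α hα) (hη H hH α hα)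
  zero_mem' := by
    intro H hH α hα
    simp
  smul_mem' := by
    intro f θ hθ H hH α hα
    simpa using Dvd.dvd.mul_left (hθ H hH α hα) f

/-- A central arrangement `A` is free if `D(A)` is a free `S`-module. -/
def IsFreeArrangement {K σ : Type*} [Field K] [Fintype σ] [DecidableEq σ]
    (A : Set (Submodule K (σ → K))) : Prop :=
  Module.Free (MvPolynomial σ K) (logDerivations A)

/-- The cone over an arrangement `A` of affine hyperplanes of `K^σ`. It is a central arrangement
in `K^(σ ∪ {z})`, where `none : Option σ` is the index of the additional coordinate `z`.
It consists of the hyperplane `z = 0` and of the homogenization `α(x) - c z = 0` of each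
hyperplane `α(x) = c` in `A`. -/
def cone {K σ : Type*} [Field K] (A : Set (Set (σ → K))) :
    Set (Submodule K (Option σ → K)) :=
  {LinearMap.ker (LinearMap.proj none : (Option σ → K) →ₗ[K] K)} ∪
  {H | ∃ (α : Module.Dual K (σ → K)) (c : K), α ≠ 0 ∧ {x | α x = c} ∈ A ∧
    H = LinearMap.ker
      (α ∘ₗ LinearMap.funLeft K K (some : σ → Option σ) -
        c • (LinearMap.proj none : (Option σ → K) →ₗ[K] K))}

end Arrangements

section Graphs

/-- The complete graph on `ℓ` vertices as the set of directed edges `(i, j)` with `i < j`.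
The element `i : Fin ℓ` stands for the vertex with label `i + 1 ∈ {1, …, ℓ}`. -/
def completeEdges (ℓ : ℕ) : Set (Fin ℓ × Fin ℓ) := {e | e.1 < e.2}

/-- The Coxeter arrangement of type `A_{ℓ-1}`: the hyperplanes `x_i - x_j = 0` for `i < j`. -/
def coxeter (K : Type*) [Field K] (ℓ : ℕ) : Set (Set (Fin ℓ → K)) :=
  {H | ∃ i j : Fin ℓ, i < j ∧ H = {x | x i - x j = 0}}

/-- The deleted Ish arrangement: the Coxeter arrangement together with, for each edge of `G` from
the vertex with label `i` to the vertex with label `j`, the hyperplane `x_1 - x_j = i`.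
The first coordinate is `x 0`, and the label of `i : Fin ℓ` is `i + 1`. -/
def deletedIsh (K : Type*) [Field K] (ℓ : ℕ) [NeZero ℓ] (G : Set (Fin ℓ × Fin ℓ)) :
    Set (Set (Fin ℓ → K)) :=
  coxeter K ℓ ∪
  {H | ∃ i j : Fin ℓ, (i, j) ∈ G ∧ H = {x | x 0 - x j = (((i : ℕ) + 1 : ℕ) : K)}}

/-- The vertices with labels `2, …, ℓ`. -/
abbrev NonfirstVertex (ℓ : ℕ) [NeZero ℓ] : Type := {j : Fin ℓ // 0 < j}

/-- The tuple `N_G = (N_2, …, N_ℓ)` of subsets of `K`, where `N_j` consists of `0` and of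
the labels `i` of the vertices with an edge to `j`. -/
def ishTuple (K : Type*) [Field K] (ℓ : ℕ) [NeZero ℓ] (G : Set (Fin ℓ × Fin ℓ)) :
    NonfirstVertex ℓ → Set K :=
  fun j => {0} ∪ {a | ∃ i : Fin ℓ, (i, j.1) ∈ G ∧ a = (((i : ℕ) + 1 : ℕ) : K)}

/-- A tuple of subsets of `K` indexed by `{2, …, ℓ}` is a nest if it can be permuted to
an increasing chain `N_{w(2)} ⊆ N_{w(3)} ⊆ … ⊆ N_{w(ℓ)}`. -/
def IsNest {K : Type*} {ℓ : ℕ} [NeZero ℓ] (N : NonfirstVertex ℓ → Set K) : Prop :=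
  ∃ w : Equiv.Perm (NonfirstVertex ℓ), ∀ i j, i ≤ j → N (w i) ⊆ N (w j)

/-- The relabelled graph `w⁻¹G = {(w⁻¹(i), w⁻¹(j)) | (i, j) ∈ G}`. -/
def relabel {ℓ : ℕ} (w : Equiv.Perm (Fin ℓ)) (G : Set (Fin ℓ × Fin ℓ)) :
    Set (Fin ℓ × Fin ℓ) :=
  (fun e => (w.symm e.1, w.symm e.2)) '' G

/-- Athanasiadis' condition on `G`. -/
def AthanasiadisCondition {ℓ : ℕ} (G : Set (Fin ℓ × Fin ℓ)) : Prop :=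
  ∃ w : Equiv.Perm (Fin ℓ), relabel w G ⊆ completeEdges ℓ ∧
    ∀ i j k : Fin ℓ, i < j → j < k → (i, j) ∈ relabel w G → (i, k) ∈ relabel w G

/-- For any two vertices `j`, `k` with labels in `{2, …, ℓ}`, every edge `(i, j)` of `G` yields
an edge `(i, k)`, or every edge `(i, k)` of `G` yields an edge `(i, j)`. -/
def PairwiseInclusion {ℓ : ℕ} [NeZero ℓ] (G : Set (Fin ℓ × Fin ℓ)) : Prop :=
  ∀ j k : NonfirstVertex ℓ,
    (∀ i : Fin ℓ, (i, j.1) ∈ G → (i, k.1) ∈ G) ∨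
    (∀ i : Fin ℓ, (i, k.1) ∈ G → (i, j.1) ∈ G)

end Graphs

end DeletedIsh

/-! Write u_j = x_1 - x_j. In the coordinates z, x_1, u_j, a derivation θ is logarithmic iff z ∣
θ(z), u_j - az ∣ θ(u_j - az) for a ∈ N_j, and u_j - u_k ∣ θ(u_j - u_k).

Nest implies free: there is an explicit basis consisting of the Euler derivation, ∑ ∂/∂x_i, and for
each k the derivation u_m ↦ F_k(u_m) killing z and x_1, where F_k(t) is the product of t - az over a
∈ N_k and of t - u_i over the i after k in the chain. It is triangular, and its diagonal entries are
products of pairwise coprime forms that must divide the corresponding value of any suitable θ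
(`free_of_triangular`, `prod_rootForm_sub_dvd`).

Free implies nest: take j ≠ k with |N_j| ≤ |N_k|, and put u = u_j, v = u_k. The derivation with
values ∏_{N_j}(u - az) · u^{|N_k| - |N_j|} at u and ∏_{N_k}(v - bz) at v, times the product of the
other u - u_i and v - u_i, satisfies the condition at u - v only modulo z. Since (u - v, z) is a
regular pair along which u is not a zero divisor, freeness allows it to be corrected, modulo z, to a
logarithmic α (`exists_planeDerivation_eq`). If a ∈ N_j ∖ N_k, then on u = v = az the
Euler-corrected α(v) vanishes while its factor ∏_{N_k}(v - bz) does not. So the cofactor vanishes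
there, and in particular at z = 0, where it must equal the nonzero product of the other forms.

The other equivalences are sorting of pairwise comparable finite sets. -/

open MvPolynomial

namespace DeletedIsh

/-! ### Independence of the choice of defining form of a hyperplane -/

section LinearForms

variable {K σ : Type*} [Field K] [Fintype σ] [DecidableEq σ]

lemma linearFormPoly_smul (c : K) (α : Module.Dual K (σ → K)) :
    linearFormPoly (c • α) = C c * linearFormPoly α := by
  simp [linearFormPoly, Finset.mul_sum, mul_assoc]

/-- Kernel inclusion makes α a scalar multiple of β. Hence testing one defining form per hyperplane
is enough. -/
lemma linearFormPoly_dvd_of_ker_le {α β : Module.Dual K (σ → K)}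
    (h : LinearMap.ker β ≤ LinearMap.ker α)
    {θ : Derivation K (MvPolynomial σ K) (MvPolynomial σ K)}
    (hθ : linearFormPoly β ∣ θ (linearFormPoly β)) :
    linearFormPoly α ∣ θ (linearFormPoly α) := by
  have hm : α ∈ Submodule.span K (Set.range fun _ : Unit => β) :=
    mem_span_of_iInf_ker_le_ker (by simpa using h)
  obtain ⟨c, rfl⟩ : ∃ c : K, c • β = α := by
    simpa [Submodule.mem_span_singleton] using hm
  rw [linearFormPoly_smul, C_mul', Derivation.map_smul, smul_eq_C_mul, smul_eq_C_mul]
  exact mul_dvd_mul_left _ hθ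

lemma linearFormPoly_proj (i : σ) :
    linearFormPoly (LinearMap.proj i : (σ → K) →ₗ[K] K) = X i := by
  simp [linearFormPoly, Pi.single_apply]

omit [Fintype σ] [DecidableEq σ] in
/-- Linear forms whose affine level sets are contained in each other are proportional,
together with their levels. -/
lemma homogenize_of_level_subset {α β : Module.Dual K (σ → K)} {c d : K} (hβ : β ≠ 0)
    (h : {x | β x = d} ⊆ {x | α x = c}) (x : σ → K) (t : K) (hx : β x = d * t) :
    α x = c * t := by
  obtain ⟨v, hv⟩ : ∃ v, β v ≠ 0 := by
    by_contra! hv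
    exact hβ (LinearMap.ext hv)
  set x₀ := (d / β v) • v with hx₀
  have h0 : β x₀ = d := by simp [hx₀, hv]
  have h1 : α x₀ = c := h h0
  have h2 : α (x₀ + (x - t • x₀)) = c := h (by simp [h0, hx, mul_comm])
  simp only [map_add, map_sub, map_smul, h1, smul_eq_mul] at h2
  linear_combination h2

end LinearForms

/-! ### Cones over arrangements of hyperplanes x_i - x_j = c -/

section Cone

variable {K : Type*} [Field K] {ℓ : ℕ}

/-- The linear form `x_i - x_j`. -/
def diffForm (K : Type*) [Field K] {ℓ : ℕ} (i j : Fin ℓ) : Module.Dual K (Fin ℓ → K) :=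
  (LinearMap.proj i : (Fin ℓ → K) →ₗ[K] K) - LinearMap.proj j

@[simp] lemma diffForm_apply (i j : Fin ℓ) (x : Fin ℓ → K) : diffForm K i j x = x i - x j := rfl

lemma diffForm_ne_zero {i j : Fin ℓ} (h : i ≠ j) : diffForm K i j ≠ 0 := by
  intro h0
  have := congrArg (fun f => f (Pi.single i 1)) h0
  simp [h.symm] at this

lemma linearFormPoly_cone_diffForm (i j : Fin ℓ) (c : K) :
    linearFormPoly (diffForm K i j ∘ₗ LinearMap.funLeft K K (some : Fin ℓ → Option (Fin ℓ)) -
        c • (LinearMap.proj none : (Option (Fin ℓ) → K) →ₗ[K] K)) =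
      X (some i) - X (some j) - C c * X none := by
  simp only [linearFormPoly, Fintype.sum_option]
  simp [LinearMap.funLeft, Pi.single_apply, sub_mul, Finset.sum_sub_distrib, ite_mul]
  ring

/-- The logarithmic derivations of the cone over an arrangement of hyperplanes `x_i - x_j = c`,
in terms of these defining forms. -/
lemma mem_logDerivations_cone {A : Set (Set (Fin ℓ → K))} {E : Fin ℓ → Fin ℓ → K → Prop}
    (hE : ∀ i j c, E i j c → i ≠ j)
    (hA : ∀ H, H ∈ A ↔ ∃ i j c, E i j c ∧ H = {x | x i - x j = c})
    {θ : Derivation K (MvPolynomial (Option (Fin ℓ)) K) (MvPolynomial (Option (Fin ℓ)) K)} :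
    θ ∈ logDerivations (cone A) ↔ X none ∣ θ (X none) ∧
      ∀ i j c, E i j c → X (some i) - X (some j) - C c * X none ∣
        θ (X (some i) - X (some j) - C c * X none) := by
  constructor
  · intro h
    refine ⟨?_, fun i j c he => ?_⟩
    · have := h _ (Or.inl rfl) _ rfl
      rwa [linearFormPoly_proj] at this
    · have := h _ (Or.inr ⟨diffForm K i j, c, diffForm_ne_zero (hE i j c he),
        (hA _).2 ⟨i, j, c, he, rfl⟩, rfl⟩) _ rfl
      rwa [linearFormPoly_cone_diffForm] at this
  · rintro ⟨h0, h⟩ H (rfl | ⟨α, c, -, hm, rfl⟩) γ hγ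
    · exact linearFormPoly_dvd_of_ker_le hγ.ge (by rwa [linearFormPoly_proj])
    · obtain ⟨i, j, d, he, heq⟩ := (hA _).1 hm
      refine linearFormPoly_dvd_of_ker_le (β := diffForm K i j ∘ₗ
        LinearMap.funLeft K K (some : Fin ℓ → Option (Fin ℓ)) -
        d • (LinearMap.proj none : (Option (Fin ℓ) → K) →ₗ[K] K)) ?_
        (by rw [linearFormPoly_cone_diffForm]; exact h i j d he)
      rw [hγ]
      intro x hx
      have := homogenize_of_level_subset (α := α) (c := c) (d := d)
        (diffForm_ne_zero (K := K) (hE i j d he)) heq.ge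
        (x ∘ some) (x none) (by
          simpa [LinearMap.funLeft, sub_eq_zero] using hx)
      simpa [LinearMap.funLeft, sub_eq_zero] using this

/-- A form of degree one is irreducible once its coefficients have no common nonunit factor; here
the coefficient of x_j is -1. -/
lemma irreducible_sub_sub {i j : Fin ℓ} (h : i ≠ j) (c : K) :
    Irreducible (X (some i) - X (some j) - C c * X none : MvPolynomial (Option (Fin ℓ)) K) := by
  have hc : coeff (Finsupp.single (some j) 1)
      (X (some i) - X (some j) - C c * X none : MvPolynomial (Option (Fin ℓ)) K) = -1 := by
    simp [coeff_C_mul, coeff_X, Finsupp.single_left_inj, h]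
  apply irreducible_of_totalDegree_eq_one
  · refine IsHomogeneous.totalDegree ?_ ?_
    · exact ((isHomogeneous_X _ _).sub (isHomogeneous_X _ _)).sub
        (by simpa using (isHomogeneous_C _ c).mul (isHomogeneous_X K (none : Option (Fin ℓ))))
    · intro h0
      simp [h0] at hc
  · intro x hx
    have := hx (Finsupp.single (some j) 1)
    rw [hc] at this
    exact isUnit_of_dvd_unit this (by simp)

end Cone

/-! ### Logarithmic conditions in the coordinates z, x_1, x_1 - x_j -/

section Ish

variable {K : Type*} [Field K] {ℓ : ℕ} [NeZero ℓ]

/-- The linear form `x_1 - x_j` as a polynomial. -/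
noncomputable def rootForm (K : Type*) [Field K] {ℓ : ℕ} [NeZero ℓ] (j : NonfirstVertex ℓ) :
    MvPolynomial (Option (Fin ℓ)) K :=
  X (some 0) - X (some j.1)

lemma mem_deletedIsh_iff {G : Set (Fin ℓ × Fin ℓ)} (H : Set (Fin ℓ → K)) :
    H ∈ deletedIsh K ℓ G ↔ ∃ i j c, ((i < j ∧ c = 0) ∨
      (i = 0 ∧ ∃ m : Fin ℓ, (m, j) ∈ G ∧ c = (((m : ℕ) + 1 : ℕ) : K))) ∧
      H = {x | x i - x j = c} := by
  constructor
  · rintro (⟨i, j, hij, rfl⟩ | ⟨i, j, hij, rfl⟩)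
    · exact ⟨i, j, 0, Or.inl ⟨hij, rfl⟩, rfl⟩
    · exact ⟨0, j, _, Or.inr ⟨rfl, i, hij, rfl⟩, rfl⟩
  · rintro ⟨i, j, c, ⟨hlt, rfl⟩ | ⟨rfl, m, hm, rfl⟩, rfl⟩
    · exact Or.inl ⟨i, j, hlt, rfl⟩
    · exact Or.inr ⟨m, j, hm, rfl⟩

/-- The Coxeter hyperplanes through x_1 are absorbed into the element 0 of N_j, and the remaining
ones are differences of root forms. -/
lemma mem_logDerivations_deletedIsh {G : Set (Fin ℓ × Fin ℓ)} (hG : G ⊆ completeEdges ℓ)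
    {θ : Derivation K (MvPolynomial (Option (Fin ℓ)) K) (MvPolynomial (Option (Fin ℓ)) K)} :
    θ ∈ logDerivations (cone (deletedIsh K ℓ G)) ↔ X none ∣ θ (X none) ∧
      (∀ j, ∀ a ∈ ishTuple K ℓ G j,
        rootForm K j - C a * X none ∣ θ (rootForm K j - C a * X none)) ∧
      ∀ j k, j ≠ k → rootForm K j - rootForm K k ∣ θ (rootForm K j - rootForm K k) := by
  have hpos : ∀ {m j : Fin ℓ}, (m, j) ∈ G → 0 < j := fun h =>
    lt_of_le_of_lt (Fin.zero_le _) (hG h)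
  rw [mem_logDerivations_cone (fun i j c h => ?_) mem_deletedIsh_iff]
  · refine and_congr_right fun _ => ⟨fun h => ⟨fun j a ha => ?_, fun j k hjk => ?_⟩, fun h => ?_⟩
    · rcases ha with ha | ⟨i, hi, ha⟩
      · exact h 0 j.1 a (Or.inl ⟨j.2, ha⟩)
      · exact h 0 j.1 a (Or.inr ⟨rfl, i, hi, ha⟩)
    · have e1 : rootForm K j - rootForm K k = X (some k.1) - X (some j.1) := by
        simp [rootForm]
      rw [e1]
      rcases lt_or_gt_of_ne (fun h => hjk (Subtype.ext h)) with hlt | hlt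
      · have := h j.1 k.1 0 (Or.inl ⟨hlt, rfl⟩)
        rw [C_0, zero_mul, sub_zero] at this
        rw [← neg_sub, map_neg, neg_dvd, dvd_neg]
        exact this
      · have := h k.1 j.1 0 (Or.inl ⟨hlt, rfl⟩)
        rwa [C_0, zero_mul, sub_zero] at this
    · rintro i j c (⟨hlt, hc⟩ | ⟨rfl, m, hm, hc⟩)
      · have hj : 0 < j := lt_of_le_of_lt (Fin.zero_le i) hlt
        rcases eq_or_ne i 0 with rfl | hi
        · exact h.1 ⟨j, hj⟩ c (Or.inl hc)
        · have := h.2 ⟨j, hj⟩ ⟨i, Fin.pos_iff_ne_zero.2 hi⟩ (fun h => hlt.ne' (Subtype.ext_iff.1 h))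
          rw [hc, C_0, zero_mul, sub_zero]
          simpa only [rootForm, sub_sub_sub_cancel_left] using this
      · exact h.1 ⟨j, hpos hm⟩ c (Or.inr ⟨m, hm, hc⟩)
  · rcases h with ⟨hlt, -⟩ | ⟨rfl, m, hm, -⟩
    · exact hlt.ne
    · exact (hpos hm).ne

/-- The form `a z` for `a : K`, and the form `x_1 - x_i` for a vertex `i`. -/
noncomputable def rootValue : K ⊕ NonfirstVertex ℓ → MvPolynomial (Option (Fin ℓ)) K :=
  Sum.elim (fun a => C a * X none) (rootForm K)

lemma rootValue_inl (a : K) : rootValue (Sum.inl a) =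
    (C a * X none : MvPolynomial (Option (Fin ℓ)) K) := rfl

lemma irreducible_rootForm_sub (k : NonfirstVertex ℓ) (s : K ⊕ NonfirstVertex ℓ)
    (hs : s ≠ Sum.inr k) : Irreducible (rootForm K k - rootValue s) := by
  rcases s with a | i
  · exact irreducible_sub_sub k.2.ne a
  · have hki : i.1 ≠ k.1 := fun h => hs (by rw [Subtype.ext h])
    simpa [rootForm, rootValue] using irreducible_sub_sub hki (0 : K)

/-- The forms `x_1 - x_k - r`, for distinct `r` of the shape `a z` or `x_1 - x_i` with `i ≠ k`,
are pairwise coprime. -/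
lemma prod_rootForm_sub_dvd (k : NonfirstVertex ℓ) (T : Finset (K ⊕ NonfirstVertex ℓ))
    (hT : Sum.inr k ∉ T) {p : MvPolynomial (Option (Fin ℓ)) K}
    (hp : ∀ s ∈ T, rootForm K k - rootValue s ∣ p) :
    ∏ s ∈ T, (rootForm K k - rootValue s) ∣ p := by
  classical
  refine Finset.prod_dvd_of_isRelPrime ?_ hp
  intro s hs s' hs' hne
  have hirr := irreducible_rootForm_sub k s (fun h => hT (h ▸ hs))
  refine hirr.isRelPrime_iff_not_dvd.2 fun hdvd => ?_
  -- Divisibility would force the second form to vanish wherever the first does. Each case below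
  -- picks a zero of the first form at which this is impossible for s ≠ s'.
  have key : ∀ f : Option (Fin ℓ) → K, aeval f (rootForm K k - rootValue s) = 0 →
      aeval f (rootForm K k - rootValue s') = 0 := by
    rintro f hf
    obtain ⟨q, hq⟩ := hdvd
    have h2 := congrArg (aeval f) hq
    rwa [map_mul, hf, zero_mul] at h2
  have hk0 : k.1 ≠ 0 := k.2.ne'
  rcases s with a | i <;> rcases s' with a' | i'
  · have := key (fun o => o.elim 1 (fun m => if m = k.1 then -a else 0))
      (by simp [rootForm, rootValue, hk0.symm])
    simp [rootForm, rootValue, hk0.symm, sub_eq_zero] at this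
    exact hne (by rw [this])
  · have hi : i'.1 ≠ k.1 := fun h => hT (Subtype.ext h ▸ hs')
    have hi0 : i'.1 ≠ 0 := i'.2.ne'
    have := key (fun o => o.elim 0 (fun m => if m = i'.1 then 1 else 0))
      (by simp [rootForm, rootValue, hi0.symm, hi.symm])
    simp [rootForm, rootValue, hi.symm] at this
  · have hi : i.1 ≠ k.1 := fun h => hT (Subtype.ext h ▸ hs)
    have hi0 : i.1 ≠ 0 := i.2.ne'
    have := key (fun o => o.elim 0 (fun m => if m = 0 then 0 else 1))
      (by simp [rootForm, rootValue, hi0, hk0])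
    simp [rootForm, rootValue, hk0] at this
  · have hi' : i'.1 ≠ k.1 := fun h => hT (Subtype.ext h ▸ hs')
    have hi : i.1 ≠ i'.1 := fun h => hne (by rw [Subtype.ext h])
    have hi0' : i'.1 ≠ 0 := i'.2.ne'
    have := key (fun o => o.elim 0 (fun m => if m = i'.1 then 1 else 0))
      (by simp [rootForm, rootValue, hi'.symm, hi])
    simp [rootForm, rootValue, hi'.symm] at this

end Ish

/-! ### Equivalence of the three combinatorial conditions -/

section Combinatorics

lemma exists_perm_monotone {α : Type*} [Fintype α] [LinearOrder α] (f : α → ℕ) :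
    ∃ w : Equiv.Perm α, Monotone (f ∘ w) := by
  let e : Fin (Fintype.card α) ≃o α := Fintype.orderIsoFinOfCardEq α rfl
  refine ⟨e.symm.toEquiv.trans ((Tuple.sort (f ∘ e)).trans e.toEquiv), fun a b hab => ?_⟩
  simpa using Tuple.monotone_sort (f ∘ e) (e.symm.monotone hab)

/-- Pairwise comparable finite sets are sorted by their cardinalities. -/
lemma exists_perm_subset {α β : Type*} [Fintype α] [LinearOrder α] (N : α → Set β)
    (hfin : ∀ j, (N j).Finite) (h : ∀ j k, N j ⊆ N k ∨ N k ⊆ N j) :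
    ∃ w : Equiv.Perm α, ∀ i j, i ≤ j → N (w i) ⊆ N (w j) := by
  obtain ⟨w, hw⟩ := exists_perm_monotone fun j => (N j).ncard
  refine ⟨w, fun i j hij => ?_⟩
  rcases h (w i) (w j) with h1 | h1
  · exact h1
  · exact (Set.eq_of_subset_of_ncard_le h1 (hw hij) (hfin _)).ge

variable {ℓ : ℕ} [NeZero ℓ]

/-- Characteristic 0 enters here: the labels 1, …, ℓ are distinct and nonzero in K, so N_j
determines the edges into j. -/
lemma ishTuple_subset_iff (K : Type*) [Field K] [CharZero K] (G : Set (Fin ℓ × Fin ℓ))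
    (j k : NonfirstVertex ℓ) :
    ishTuple K ℓ G j ⊆ ishTuple K ℓ G k ↔ ∀ i, (i, j.1) ∈ G → (i, k.1) ∈ G := by
  constructor
  · intro h i hi
    rcases h (Or.inr ⟨i, hi, rfl⟩) with h0 | ⟨i', hi', he⟩
    · exact absurd h0 (Nat.cast_ne_zero.2 (Nat.succ_ne_zero _))
    · have := Nat.cast_injective (R := K) he
      rwa [Fin.ext (Nat.succ_injective this)]
  · rintro h a (ha | ⟨i, hi, ha⟩)
    · exact Or.inl ha
    · exact Or.inr ⟨i, h i hi, ha⟩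

lemma finite_ishTuple (K : Type*) [Field K] (G : Set (Fin ℓ × Fin ℓ)) (j : NonfirstVertex ℓ) :
    (ishTuple K ℓ G j).Finite := by
  refine (Set.finite_singleton 0).union ((Set.finite_range fun i : Fin ℓ =>
    (((i : ℕ) + 1 : ℕ) : K)).subset ?_)
  rintro a ⟨i, -, ha⟩
  exact ⟨i, ha.symm⟩

lemma isNest_iff_pairwiseInclusion (K : Type*) [Field K] [CharZero K]
    (G : Set (Fin ℓ × Fin ℓ)) : IsNest (ishTuple K ℓ G) ↔ PairwiseInclusion G := by
  constructor
  · rintro ⟨w, hw⟩ j k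
    rw [← ishTuple_subset_iff K, ← ishTuple_subset_iff K]
    rcases le_total (w.symm j) (w.symm k) with h | h
    · exact Or.inl (by simpa using hw _ _ h)
    · exact Or.inr (by simpa using hw _ _ h)
  · intro h
    refine exists_perm_subset _ (finite_ishTuple K G) fun j k => ?_
    rw [ishTuple_subset_iff K, ishTuple_subset_iff K]
    exact h j k

lemma athanasiadisCondition_iff_pairwiseInclusion {G : Set (Fin ℓ × Fin ℓ)}
    (hG : G ⊆ completeEdges ℓ) : AthanasiadisCondition G ↔ PairwiseInclusion G := by
  have hmem : ∀ (w : Equiv.Perm (Fin ℓ)) i j, (i, j) ∈ relabel w G ↔ (w i, w j) ∈ G := by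
    intro w i j
    constructor
    · rintro ⟨⟨a, b⟩, hab, he⟩
      simp only [Prod.mk.injEq] at he
      simpa [← he.1, ← he.2] using hab
    · intro h
      exact ⟨_, h, by simp⟩
  constructor
  · rintro ⟨w, hsub, hw⟩
    have key : ∀ j k, w.symm j ≤ w.symm k → ∀ i, (i, j) ∈ G → (i, k) ∈ G := by
      intro j k hjk i hi
      rcases hjk.eq_or_lt with he | hlt
      · rwa [← w.symm.injective he]
      · have h1 : (w.symm i, w.symm j) ∈ relabel w G := (hmem _ _ _).2 (by simpa using hi)
        have h2 := (hmem _ _ _).1 (hw _ _ _ (hsub h1) hlt h1)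
        simpa using h2
    intro j k
    exact (le_total (w.symm j.1) (w.symm k.1)).imp (key _ _) (key _ _)
  · intro h
    have hpos : ∀ {i j : Fin ℓ}, (i, j) ∈ G → 0 < j := fun h =>
      lt_of_le_of_lt (Fin.zero_le _) (hG h)
    -- Sort all vertices by their sets of in-neighbours; the first vertex has none, so it is
    -- comparable with every other.
    obtain ⟨w, hw⟩ := exists_perm_subset (fun j : Fin ℓ => {i | (i, j) ∈ G})
      (fun _ => Set.toFinite _) (fun j k => by
        rcases eq_or_ne j 0 with rfl | hj
        · exact Or.inl fun i hi => absurd (hpos hi) (lt_irrefl _)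
        rcases eq_or_ne k 0 with rfl | hk
        · exact Or.inr fun i hi => absurd (hpos hi) (lt_irrefl _)
        exact h ⟨j, Fin.pos_iff_ne_zero.2 hj⟩ ⟨k, Fin.pos_iff_ne_zero.2 hk⟩)
    refine ⟨w, ?_, ?_⟩
    · rintro ⟨i, j⟩ hij
      rw [hmem] at hij
      by_contra hle
      -- If j ≤ i, the inclusion of in-neighbours would turn the edge (w i, w j) into a loop at w i.
      exact lt_irrefl (w i) (hG (hw j i (not_lt.1 hle) hij))
    · intro i j k _ hjk hij
      rw [hmem] at hij ⊢
      exact hw j k hjk.le hij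

end Combinatorics

/-! ### A triangular criterion for freeness -/

section Triangular

/-- A module with injective coordinates is free if it has a family of elements that is triangular
in these coordinates and whose diagonal coordinates divide those of all suitable elements. -/
lemma free_of_triangular {R M ι : Type*} [CommRing R] [IsDomain R] [AddCommGroup M] [Module R M]
    [Fintype ι] (r : ι → ℕ) (hr : Function.Injective r) (c : M →ₗ[R] ι → R)
    (hc : Function.Injective c) (b : ι → M) (hb : ∀ i j, r j < r i → c (b i) j = 0)
    (hbi : ∀ i, c (b i) i ≠ 0)
    (hdvd : ∀ i x, (∀ j, r j < r i → c x j = 0) → c (b i) i ∣ c x i) :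
    Module.Free R M := by
  classical
  have hli : LinearIndependent R b := by
    rw [Fintype.linearIndependent_iff]
    intro g hg
    have key : ∀ n i, r i = n → g i = 0 := by
      intro n
      induction n using Nat.strong_induction_on with
      | _ n ih =>
        intro i hi
        have h1 : ∑ j, g j * c (b j) i = 0 := by
          simpa using congrFun (congrArg c hg) i
        rw [Finset.sum_eq_single i] at h1
        · exact (mul_eq_zero.1 h1).resolve_right (hbi i)
        · intro j _ hj
          rcases lt_or_gt_of_ne (fun h => hj (hr h)) with hlt | hlt
          · rw [ih (r j) (hi ▸ hlt) j rfl, zero_mul]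
          · rw [hb j i hlt, mul_zero]
        · simp
    exact fun i => key _ i rfl
  -- Gaussian elimination in order of rank: once the lower coordinates vanish, the diagonal entry
  -- divides the next one.
  have hspan : ∀ n x, ∃ s ∈ Submodule.span R (Set.range b), ∀ j, r j < n → c (x - s) j = 0 := by
    intro n x
    induction n with
    | zero => exact ⟨0, zero_mem _, by simp⟩
    | succ n ih =>
      obtain ⟨s, hs, hsx⟩ := ih
      by_cases hn : ∃ i, r i = n
      · obtain ⟨i, rfl⟩ := hn
        obtain ⟨q, hq⟩ := hdvd i (x - s) hsx
        refine ⟨s + q • b i, add_mem hs (Submodule.smul_mem _ _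
          (Submodule.subset_span ⟨i, rfl⟩)), fun j hj => ?_⟩
        have h2 : c (x - (s + q • b i)) j = c (x - s) j - q * c (b i) j := by
          simp [sub_sub]
        rw [h2]
        rcases (Nat.lt_succ_iff.1 hj).eq_or_lt with he | hlt
        · rw [hr he, hq]
          ring
        · rw [hsx j hlt, hb i j hlt]
          ring
      · refine ⟨s, hs, fun j hj => hsx j ?_⟩
        exact lt_of_le_of_ne (Nat.lt_succ_iff.1 hj) fun h => hn ⟨j, h⟩
  refine Module.Free.of_basis (Module.Basis.mk hli fun x _ => ?_)
  obtain ⟨s, hs, hsx⟩ := hspan (Finset.univ.sup r + 1) x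
  have : x - s = 0 := hc (by
    ext j
    rw [hsx j (Nat.lt_succ_iff.2 (Finset.le_sup (Finset.mem_univ j)))]
    simp)
  rwa [sub_eq_zero.1 this]

end Triangular

/-! ### A nest gives an explicit basis -/

section NestFree

variable {K : Type*} [Field K] {ℓ : ℕ} [NeZero ℓ]

/-- The derivation with prescribed values at `z`, at `x_1` and at the forms `x_1 - x_j`. -/
noncomputable def rootDerivation (p q : MvPolynomial (Option (Fin ℓ)) K)
    (f : NonfirstVertex ℓ → MvPolynomial (Option (Fin ℓ)) K) :
    Derivation K (MvPolynomial (Option (Fin ℓ)) K) (MvPolynomial (Option (Fin ℓ)) K) :=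
  mkDerivation K fun o => o.elim p fun i => if h : 0 < i then q - f ⟨i, h⟩ else q

@[simp] lemma rootDerivation_none (p q : MvPolynomial (Option (Fin ℓ)) K)
    (f : NonfirstVertex ℓ → MvPolynomial (Option (Fin ℓ)) K) :
    rootDerivation p q f (X none) = p := by
  simp [rootDerivation, mkDerivation_X]

@[simp] lemma rootDerivation_zero (p q : MvPolynomial (Option (Fin ℓ)) K)
    (f : NonfirstVertex ℓ → MvPolynomial (Option (Fin ℓ)) K) :
    rootDerivation p q f (X (some 0)) = q := by
  simp [rootDerivation, mkDerivation_X]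

@[simp] lemma rootDerivation_rootForm (p q : MvPolynomial (Option (Fin ℓ)) K)
    (f : NonfirstVertex ℓ → MvPolynomial (Option (Fin ℓ)) K) (j : NonfirstVertex ℓ) :
    rootDerivation p q f (rootForm K j) = f j := by
  rw [rootForm, map_sub, rootDerivation_zero]
  simp [rootDerivation, mkDerivation_X, j.2]

lemma derivation_ext_rootForm
    {θ η : Derivation K (MvPolynomial (Option (Fin ℓ)) K) (MvPolynomial (Option (Fin ℓ)) K)}
    (h0 : θ (X none) = η (X none)) (h1 : θ (X (some 0)) = η (X (some 0)))
    (h : ∀ j, θ (rootForm K j) = η (rootForm K j)) : θ = η := by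
  apply derivation_ext
  rintro (_ | i)
  · exact h0
  · rcases eq_or_ne i 0 with rfl | hi
    · exact h1
    · have := h ⟨i, Fin.pos_iff_ne_zero.2 hi⟩
      simpa [rootForm, h1] using this

lemma derivation_sub_C_mul
    (θ : Derivation K (MvPolynomial (Option (Fin ℓ)) K) (MvPolynomial (Option (Fin ℓ)) K))
    (j : NonfirstVertex ℓ) (a : K) :
    θ (rootForm K j - C a * X none) = θ (rootForm K j) - C a * θ (X none) := by
  rw [map_sub, C_mul', Derivation.map_smul, C_mul']

/-- The Euler derivation. -/
noncomputable def eulerDerivation (K : Type*) [Field K] (ℓ : ℕ) [NeZero ℓ] :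
    Derivation K (MvPolynomial (Option (Fin ℓ)) K) (MvPolynomial (Option (Fin ℓ)) K) :=
  rootDerivation (X none) (X (some 0)) (rootForm K)

lemma eulerDerivation_mem {G : Set (Fin ℓ × Fin ℓ)} (hG : G ⊆ completeEdges ℓ) :
    eulerDerivation K ℓ ∈ logDerivations (cone (deletedIsh K ℓ G)) := by
  rw [mem_logDerivations_deletedIsh hG]
  refine ⟨by simp [eulerDerivation], fun j a _ => ?_, fun j k _ => ?_⟩
  · rw [derivation_sub_C_mul]
    simp [eulerDerivation]
  · simp [eulerDerivation]

/-- The forms `z`, `x_1` and `x_1 - x_j`, which make up a coordinate system. -/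
noncomputable def coordForm (K : Type*) [Field K] {ℓ : ℕ} [NeZero ℓ] (o : Option (Fin ℓ)) :
    MvPolynomial (Option (Fin ℓ)) K :=
  o.elim (X none) fun i => if h : 0 < i then rootForm K ⟨i, h⟩ else X (some 0)

@[simp] lemma coordForm_zero : coordForm K (some (0 : Fin ℓ)) = X (some 0) := by
  simp [coordForm]

@[simp] lemma coordForm_nonfirst (k : NonfirstVertex ℓ) :
    coordForm K (some k.1) = rootForm K k := by
  simp [coordForm, k.2]

/-- The values of a derivation at the forms `z`, `x_1` and `x_1 - x_j`. -/
noncomputable def coordValues (K : Type*) [Field K] (ℓ : ℕ) [NeZero ℓ] :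
    Derivation K (MvPolynomial (Option (Fin ℓ)) K) (MvPolynomial (Option (Fin ℓ)) K)
      →ₗ[MvPolynomial (Option (Fin ℓ)) K] Option (Fin ℓ) → MvPolynomial (Option (Fin ℓ)) K where
  toFun θ o := θ (coordForm K o)
  map_add' _ _ := rfl
  map_smul' _ _ := rfl

lemma option_fin_cases {p : Option (Fin ℓ) → Prop} (h1 : p none) (h2 : p (some 0))
    (h3 : ∀ k : NonfirstVertex ℓ, p (some k.1)) (o : Option (Fin ℓ)) : p o := by
  rcases o with _ | i
  · exact h1
  · rcases eq_or_ne i 0 with rfl | hi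
    · exact h2
    · exact h3 ⟨i, Fin.pos_iff_ne_zero.2 hi⟩

theorem isFreeArrangement_of_isNest {G : Set (Fin ℓ × Fin ℓ)} (hG : G ⊆ completeEdges ℓ)
    (hN : IsNest (ishTuple K ℓ G)) :
    IsFreeArrangement (cone (deletedIsh K ℓ G)) := by
  classical
  obtain ⟨w, hw⟩ := hN
  have hnest : ∀ i j, w.symm i ≤ w.symm j → ishTuple K ℓ G i ⊆ ishTuple K ℓ G j := by
    intro i j hij
    simpa using hw _ _ hij
  let N : NonfirstVertex ℓ → Finset K := fun j => (finite_ishTuple K G j).toFinset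
  let T : NonfirstVertex ℓ → Finset (K ⊕ NonfirstVertex ℓ) := fun k =>
    (N k).disjSum (Finset.univ.filter fun i => w.symm k < w.symm i)
  have hTl : ∀ k a, Sum.inl a ∈ T k ↔ a ∈ ishTuple K ℓ G k := by simp [T, N]
  have hTr : ∀ k i, Sum.inr i ∈ T k ↔ w.symm k < w.symm i := by simp [T]
  -- Applying one and the same polynomial to every u_m makes u_j - u_m divide the difference of
  -- values automatically.
  let F : NonfirstVertex ℓ → Polynomial (MvPolynomial (Option (Fin ℓ)) K) := fun k =>
    ∏ s ∈ T k, (Polynomial.X - Polynomial.C (rootValue s))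
  have hF : ∀ k t, (F k).eval t = ∏ s ∈ T k, (t - rootValue s) := by
    intro k t
    simp [F, Polynomial.eval_prod]
  let Θ : Option (Fin ℓ) → Derivation K (MvPolynomial (Option (Fin ℓ)) K)
      (MvPolynomial (Option (Fin ℓ)) K) := fun o => o.elim (eulerDerivation K ℓ) fun i =>
    if h : 0 < i then rootDerivation 0 0 fun m => (F ⟨i, h⟩).eval (rootForm K m)
    else rootDerivation 0 1 0
  have hΘk : ∀ k : NonfirstVertex ℓ, Θ (some k.1) =
      rootDerivation 0 0 fun m => (F k).eval (rootForm K m) := by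
    intro k
    simp [Θ, k.2]
  have hΘ0 : Θ (some 0) = rootDerivation 0 1 0 := by simp [Θ]
  have hzero : ∀ k m, w.symm k < w.symm m → (F k).eval (rootForm K m) = 0 := by
    intro k m hkm
    rw [hF]
    exact Finset.prod_eq_zero ((hTr k m).2 hkm) (by simp [rootValue])
  have hmem : ∀ o, Θ o ∈ logDerivations (cone (deletedIsh K ℓ G)) := by
    refine option_fin_cases (eulerDerivation_mem hG) ?_ fun k => ?_
    · rw [hΘ0, mem_logDerivations_deletedIsh hG]
      refine ⟨by simp, fun j a _ => ?_, fun j k _ => by simp⟩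
      rw [derivation_sub_C_mul]
      simp
    · rw [hΘk, mem_logDerivations_deletedIsh hG]
      refine ⟨by simp, fun j a ha => ?_, fun j m _ => ?_⟩
      · rw [derivation_sub_C_mul]
        simp only [rootDerivation_rootForm, rootDerivation_none, mul_zero, sub_zero]
        -- Vertices j after k are killed by the factor t - u_j; for the others N_j ⊆ N_k, so u_j -
        -- az is a factor. This is where the nest is needed.
        rcases lt_or_ge (w.symm k) (w.symm j) with hlt | hle
        · rw [hzero k j hlt]
          exact dvd_zero _
        · rw [hF, ← rootValue_inl]
          exact Finset.dvd_prod_of_mem (fun s => rootForm K j - rootValue s)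
            ((hTl k a).2 (hnest _ _ hle ha))
      · rw [map_sub, rootDerivation_rootForm, rootDerivation_rootForm]
        exact Polynomial.sub_dvd_eval_sub _ _ _
  let c := (coordValues K ℓ).comp (logDerivations (cone (deletedIsh K ℓ G))).subtype
  have hcn : ∀ θ, c θ none = θ.1 (X none) := fun θ => rfl
  have hc0 : ∀ θ, c θ (some 0) = θ.1 (X (some 0)) := fun θ => by
    rw [← coordForm_zero]; rfl
  have hck : ∀ θ (k : NonfirstVertex ℓ), c θ (some k.1) = θ.1 (rootForm K k) :=
    fun θ k => by rw [← coordForm_nonfirst]; rfl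
  -- Order of elimination: z, then x_1, then the vertices from the end of the chain to its
  -- beginning.
  let r : Option (Fin ℓ) → ℕ := fun o => o.elim 0 fun i =>
    if h : 0 < i then 2 + (ℓ - (w.symm ⟨i, h⟩).1.1) else 1
  have hrn : r none = 0 := rfl
  have hr0 : r (some 0) = 1 := by simp [r]
  have hrk : ∀ k : NonfirstVertex ℓ, r (some k.1) = 2 + (ℓ - (w.symm k).1.1) := by
    intro k
    simp [r, k.2]
  have hrlt : ∀ k m : NonfirstVertex ℓ, r (some k.1) < r (some m.1) ↔ w.symm m < w.symm k := by
    intro k m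
    rw [hrk, hrk, ← Subtype.coe_lt_coe, Fin.lt_def]
    have := (w.symm k).1.2
    have := (w.symm m).1.2
    omega
  refine free_of_triangular (R := MvPolynomial (Option (Fin ℓ)) K)
    (M := logDerivations (cone (deletedIsh K ℓ G))) r ?_ c ?_ (fun o => ⟨Θ o, hmem o⟩) ?_ ?_ ?_
  · refine option_fin_cases ?_ ?_ fun k => ?_ <;> refine option_fin_cases ?_ ?_ fun m => ?_ <;>
      intro h <;> (try rfl) <;> (try simp only [hrn, hr0, hrk] at h) <;> (try omega)
    have h1 := (w.symm k).1.2
    have h2 := (w.symm m).1.2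
    have : w.symm k = w.symm m := Subtype.ext (Fin.ext (by omega))
    rw [w.symm.injective this]
  · intro θ η h
    refine Subtype.ext (derivation_ext_rootForm ?_ ?_ fun k => ?_)
    · exact congrFun h none
    · simpa only [hc0] using congrFun h (some 0)
    · simpa only [hck] using congrFun h (some k.1)
  · refine option_fin_cases ?_ ?_ fun k => ?_ <;> refine option_fin_cases ?_ ?_ fun m => ?_ <;>
      simp only [hcn, hc0, hck, hΘ0, hΘk, rootDerivation_none, rootDerivation_zero,
        rootDerivation_rootForm] <;> (try simp only [hrn, hr0, hrk]; try omega)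
    · simp
    · simp
    · simp
    · intro h
      exact hzero k m ((hrlt m k).1 (by simpa only [hrk] using h))
  · refine option_fin_cases ?_ ?_ fun k => ?_
    · rw [hcn]
      simp [Θ, eulerDerivation]
    · rw [hc0]
      simp [hΘ0]
    · rw [hck]
      simp only [hΘk, rootDerivation_rootForm, hF]
      refine Finset.prod_ne_zero_iff.2 fun s hs => (irreducible_rootForm_sub k s ?_).ne_zero
      rintro rfl
      exact lt_irrefl _ ((hTr k k).1 hs)
  · refine option_fin_cases ?_ ?_ fun k => ?_
    · intro θ _
      rw [hcn, hcn]
      simpa [Θ, eulerDerivation] using ((mem_logDerivations_deletedIsh hG).1 θ.2).1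
    · intro θ _
      rw [hc0]
      simp [hΘ0]
    · intro θ hθ
      rw [hck, hck]
      simp only [hΘk, rootDerivation_rootForm, hF]
      obtain ⟨-, hθa, hθd⟩ := (mem_logDerivations_deletedIsh hG).1 θ.2
      have hn : θ.1 (X none) = 0 := by
        simpa only [hcn] using hθ none (by rw [hrn, hrk]; omega)
      -- As θ kills z and every u_i with i after k, the conditions at u_k - az and u_k - u_i become
      -- divisibilities of θ(u_k) itself.
      refine prod_rootForm_sub_dvd k (T k) (by simp [hTr]) ?_
      rintro (a | i) hs
      · have := hθa k a ((hTl k a).1 hs)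
        rwa [derivation_sub_C_mul, hn, mul_zero, sub_zero] at this
      · have hki := (hTr k i).1 hs
        have hi : θ.1 (rootForm K i) = 0 := by
          simpa only [hck] using hθ (some i.1) ((hrlt i k).2 hki)
        have := hθd k i (by rintro rfl; exact lt_irrefl _ hki)
        rwa [map_sub, hi, sub_zero] at this

end NestFree

/-! ### Freeness forces the sets N_j to be comparable -/

section FreeNest

/-- If `f`, `z`, `g` behave like a regular sequence, a relation `g φ - f ψ ∈ z M` in a free
module `M` forces `φ ∈ f M + z M`. -/
lemma exists_eq_smul_add_smul_of_free {R M : Type*} [CommRing R] [AddCommGroup M] [Module R M]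
    [Module.Free R M] {f g z : R}
    (h : ∀ p q r : R, g * p - f * q = z * r → ∃ s t, p = f * s + z * t) {φ ψ χ : M}
    (hrel : g • φ - f • ψ = z • χ) : ∃ α β : M, φ = f • α + z • β := by
  let b := Module.Free.chooseBasis R M
  let N : Submodule R M :=
    LinearMap.range ((LinearMap.lsmul R M f).coprod (LinearMap.lsmul R M z))
  suffices hN : φ ∈ N by
    obtain ⟨⟨α, β⟩, hαβ⟩ := hN
    exact ⟨α, β, by simpa using hαβ.symm⟩
  rw [← b.linearCombination_repr φ, Finsupp.linearCombination_apply]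
  refine Submodule.sum_mem _ fun i _ => ?_
  obtain ⟨s, t, hst⟩ := h (b.repr φ i) (b.repr ψ i) (b.repr χ i) (by
    simpa using congrArg (fun x => b.repr x i) hrel)
  refine ⟨(s • b i, t • b i), ?_⟩
  simp [hst, add_smul, mul_smul, smul_comm s f, smul_comm t z]

variable {K : Type*} [Field K] {ℓ : ℕ} [NeZero ℓ]

omit [NeZero ℓ] in
lemma X_none_dvd_pow_sub_prod (u : MvPolynomial (Option (Fin ℓ)) K) (T : Finset K) :
    (X none : MvPolynomial (Option (Fin ℓ)) K) ∣
      u ^ T.card - ∏ a ∈ T, (u - C a * X none) := by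
  classical
  induction T using Finset.induction_on with
  | empty => simp
  | insert a T ha ih =>
    rw [Finset.card_insert_of_notMem ha, Finset.prod_insert ha]
    obtain ⟨q, hq⟩ := ih
    exact ⟨u * q + C a * ∏ b ∈ T, (u - C b * X none), by linear_combination u * hq⟩

/-- Modulo u_j - u_k and z the ring is again a polynomial ring, in which u_j is nonzero. The
quotient is realised by the substitution z = 0, x_j = x_k. -/
lemma rootForm_regular {j k : NonfirstVertex ℓ} (m : ℕ)
    (p q r : MvPolynomial (Option (Fin ℓ)) K)
    (h : rootForm K j ^ m * p - (rootForm K j - rootForm K k) * q = X none * r) :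
    ∃ s t, p = (rootForm K j - rootForm K k) * s + X none * t := by
  classical
  let σ : MvPolynomial (Option (Fin ℓ)) K →ₐ[K] MvPolynomial (Option (Fin ℓ)) K :=
    aeval fun o => if o = none then 0 else if o = some j.1 then X (some k.1) else X o
  have hσz : σ (X none) = 0 := by simp [σ]
  have hσj : σ (rootForm K j) = rootForm K k := by simp [σ, rootForm, j.2.ne]
  have hσk : σ (rootForm K k) = rootForm K k := by
    simp [σ, rootForm, j.2.ne]
  have hk : rootForm K k ≠ 0 := by
    have := (irreducible_sub_sub k.2.ne (0 : K)).ne_zero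
    simpa [rootForm] using this
  have hp : σ p = 0 := by
    have := congrArg σ h
    simp only [map_sub, map_mul, map_pow, hσz, hσj, hσk, sub_self, zero_mul, sub_zero] at this
    exact (mul_eq_zero.1 this).resolve_left (pow_ne_zero _ hk)
  let I : Ideal (MvPolynomial (Option (Fin ℓ)) K) :=
    Ideal.span {rootForm K j - rootForm K k, X none}
  -- The substitution is the identity modulo I, so its kernel lies in I.
  have hI : (Ideal.Quotient.mkₐ K I).comp σ = Ideal.Quotient.mkₐ K I := by
    apply algHom_ext
    rintro (_ | i)
    · simp only [AlgHom.comp_apply, hσz, map_zero, Ideal.Quotient.mkₐ_eq_mk]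
      exact (Ideal.Quotient.eq_zero_iff_mem.2 (Ideal.subset_span (by simp))).symm
    · rcases eq_or_ne i j.1 with rfl | hi
      · simp only [AlgHom.comp_apply, Ideal.Quotient.mkₐ_eq_mk]
        rw [Ideal.Quotient.eq]
        have : σ (X (some j.1)) - X (some j.1) = rootForm K j - rootForm K k := by
          simp [σ, rootForm]
        rw [this]
        exact Ideal.subset_span (by simp)
      · simp [σ, hi]
  have hmem : p ∈ I := by
    have := DFunLike.congr_fun hI p
    simp only [AlgHom.comp_apply, hp, map_zero, Ideal.Quotient.mkₐ_eq_mk] at this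
    exact Ideal.Quotient.eq_zero_iff_mem.1 this.symm
  obtain ⟨s, t, hst⟩ := Ideal.mem_span_pair.1 hmem
  exact ⟨s, t, by rw [← hst]; ring⟩

open Classical in
/-- The product of the forms `x_i - x_j` and `x_i - x_k` over all vertices `i ≠ 1, j, k`. -/
noncomputable def crossProduct (K : Type*) [Field K] {ℓ : ℕ} [NeZero ℓ]
    (j k : NonfirstVertex ℓ) : MvPolynomial (Option (Fin ℓ)) K :=
  ∏ i ∈ Finset.univ.filter (fun i => i ≠ j ∧ i ≠ k),
    ((rootForm K j - rootForm K i) * (rootForm K k - rootForm K i))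

open Classical in
/-- The derivation along the plane of the coordinates `x_j` and `x_k` with the values
`g` and `h` at `x_1 - x_j` and `x_1 - x_k`. -/
noncomputable def planeDerivation (j k : NonfirstVertex ℓ)
    (g h : MvPolynomial (Option (Fin ℓ)) K) :
    Derivation K (MvPolynomial (Option (Fin ℓ)) K) (MvPolynomial (Option (Fin ℓ)) K) :=
  rootDerivation 0 0 fun i => if i = j then g else if i = k then h else 0

lemma planeDerivation_fst (j k : NonfirstVertex ℓ) (g h : MvPolynomial (Option (Fin ℓ)) K) :
    planeDerivation j k g h (rootForm K j) = g := by
  simp [planeDerivation]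

lemma planeDerivation_snd {j k : NonfirstVertex ℓ} (hjk : j ≠ k)
    (g h : MvPolynomial (Option (Fin ℓ)) K) :
    planeDerivation j k g h (rootForm K k) = h := by
  simp [planeDerivation, hjk.symm]

lemma planeDerivation_of_ne {i j k : NonfirstVertex ℓ} (hj : i ≠ j) (hk : i ≠ k)
    (g h : MvPolynomial (Option (Fin ℓ)) K) :
    planeDerivation j k g h (rootForm K i) = 0 := by
  simp [planeDerivation, hj, hk]

lemma planeDerivation_none (j k : NonfirstVertex ℓ) (g h : MvPolynomial (Option (Fin ℓ)) K) :
    planeDerivation j k g h (X none) = 0 := by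
  simp [planeDerivation]

/-- The products over A and B handle the hyperplanes u_j = az and u_k = bz, and `crossProduct` those
joining j or k to other vertices; only x_j = x_k imposes a condition on g and h. -/
lemma planeDerivation_mem {G : Set (Fin ℓ × Fin ℓ)} (hG : G ⊆ completeEdges ℓ)
    {j k : NonfirstVertex ℓ} (hjk : j ≠ k) {A B : Finset K}
    (hA : (A : Set K) = ishTuple K ℓ G j) (hB : (B : Set K) = ishTuple K ℓ G k)
    {g h : MvPolynomial (Option (Fin ℓ)) K}
    (hgh : rootForm K j - rootForm K k ∣
      (∏ a ∈ A, (rootForm K j - C a * X none)) * g -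
      (∏ b ∈ B, (rootForm K k - C b * X none)) * h) :
    planeDerivation j k
      (crossProduct K j k * ((∏ a ∈ A, (rootForm K j - C a * X none)) * g))
      (crossProduct K j k * ((∏ b ∈ B, (rootForm K k - C b * X none)) * h)) ∈
      logDerivations (cone (deletedIsh K ℓ G)) := by
  classical
  have hcross : ∀ i, i ≠ j → i ≠ k → (rootForm K j - rootForm K i ∣ crossProduct K j k) ∧
      (rootForm K k - rootForm K i ∣ crossProduct K j k) := by
    intro i hij hik
    have := Finset.dvd_prod_of_mem
      (fun i => (rootForm K j - rootForm K i) * (rootForm K k - rootForm K i))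
      (Finset.mem_filter.2 ⟨Finset.mem_univ i, hij, hik⟩ :
        i ∈ Finset.univ.filter (fun i => i ≠ j ∧ i ≠ k))
    exact ⟨(dvd_mul_right _ _).trans this, (dvd_mul_left _ _).trans this⟩
  rw [mem_logDerivations_deletedIsh hG]
  refine ⟨by simp [planeDerivation_none], fun i a ha => ?_, ?_⟩
  · rw [derivation_sub_C_mul, planeDerivation_none, mul_zero, sub_zero]
    rcases eq_or_ne i j with rfl | hij
    · rw [planeDerivation_fst]
      rw [← hA] at ha
      exact ((Finset.dvd_prod_of_mem (fun a => rootForm K i - C a * X none)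
        (Finset.mem_coe.1 ha)).mul_right _).mul_left _
    rcases eq_or_ne i k with rfl | hik
    · rw [planeDerivation_snd hjk]
      rw [← hB] at ha
      exact ((Finset.dvd_prod_of_mem (fun a => rootForm K i - C a * X none)
        (Finset.mem_coe.1 ha)).mul_right _).mul_left _
    · rw [planeDerivation_of_ne hij hik]
      exact dvd_zero _
  · intro i i' hii
    rw [map_sub]
    rcases eq_or_ne i j with rfl | hij
    · rw [planeDerivation_fst]
      rcases eq_or_ne i' k with rfl | hik'
      · rw [planeDerivation_snd hjk, ← mul_sub]
        exact hgh.mul_left _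
      · rw [planeDerivation_of_ne hii.symm hik', sub_zero]
        exact (hcross i' hii.symm hik').1.mul_right _
    rcases eq_or_ne i k with rfl | hik
    · rw [planeDerivation_snd hjk]
      rcases eq_or_ne i' j with rfl | hij'
      · rw [planeDerivation_fst, ← mul_sub, ← neg_dvd, neg_sub, ← dvd_neg, ← mul_neg, neg_sub]
        exact hgh.mul_left _
      · rw [planeDerivation_of_ne hij' hii.symm, sub_zero]
        exact (hcross i' hij' hii.symm).2.mul_right _
    · rw [planeDerivation_of_ne hij hik, zero_sub, dvd_neg, ← neg_sub, neg_dvd]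
      rcases eq_or_ne i' j with rfl | hij'
      · rw [planeDerivation_fst]
        exact (hcross i hij hik).1.mul_right _
      rcases eq_or_ne i' k with rfl | hik'
      · rw [planeDerivation_snd hjk]
        exact (hcross i hij hik).2.mul_right _
      · rw [planeDerivation_of_ne hij' hik']
        exact dvd_zero _

/-- Freeness lifts the derivation of degree `#B` of the restriction to `z = 0`, up to the factor
`crossProduct`. -/
lemma exists_planeDerivation_eq {G : Set (Fin ℓ × Fin ℓ)} (hG : G ⊆ completeEdges ℓ)
    (hfree : IsFreeArrangement (cone (deletedIsh K ℓ G)))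
    {j k : NonfirstVertex ℓ} (hjk : j ≠ k) {A B : Finset K}
    (hA : (A : Set K) = ishTuple K ℓ G j) (hB : (B : Set K) = ishTuple K ℓ G k)
    (hcard : A.card ≤ B.card) :
    ∃ g, ∃ α ∈ logDerivations (cone (deletedIsh K ℓ G)),
      ∃ β ∈ logDerivations (cone (deletedIsh K ℓ G)),
      planeDerivation j k g (crossProduct K j k *
        ((∏ b ∈ B, (rootForm K k - C b * X none)) * (rootForm K j - rootForm K k))) =
        (rootForm K j - rootForm K k) • α + (X none : MvPolynomial (Option (Fin ℓ)) K) • β := by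
  classical
  set u := rootForm K j with hu
  set v := rootForm K k with hv
  have hmn : (A \ B).card ≤ (B \ A).card := by
    have h1 := Finset.card_sdiff_add_card_inter A B
    have h2 := Finset.card_sdiff_add_card_inter B A
    rw [Finset.inter_comm] at h2
    omega
  obtain ⟨Q₁, hQ₁⟩ := X_none_dvd_pow_sub_prod u (B \ A)
  obtain ⟨Q₂, hQ₂⟩ := X_none_dvd_pow_sub_prod u (A \ B)
  have hpow : u ^ (A \ B).card * u ^ ((B \ A).card - (A \ B).card) = u ^ (B \ A).card := by
    rw [← pow_add, Nat.add_sub_cancel' hmn]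
  -- The three derivations satisfy u^|A ∖ B| φ - (u - v) ψ = z χ. The factor u - v makes φ
  -- logarithmic.
  have hφ := planeDerivation_mem hG hjk hA hB
    (g := (u - v) * u ^ ((B \ A).card - (A \ B).card)) (h := u - v)
    (dvd_sub ((dvd_mul_right _ _).mul_left _) (dvd_mul_left _ _))
  -- Here both products, taken at u, run over A ∪ B, so the difference is a multiple of ∏_B(u - bz)
  -- - ∏_B(v - bz).
  have hψ := planeDerivation_mem hG hjk hA hB
    (g := ∏ b ∈ B \ A, (u - C b * X none)) (h := ∏ a ∈ A \ B, (u - C a * X none)) (by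
      have e : (∏ a ∈ A, (u - C a * X none)) * ∏ b ∈ B \ A, (u - C b * X none) =
          (∏ b ∈ B, (u - C b * X none)) * ∏ a ∈ A \ B, (u - C a * X none) := by
        rw [mul_comm, mul_comm (∏ b ∈ B, _), ← Finset.prod_union Finset.sdiff_disjoint,
          ← Finset.prod_union Finset.sdiff_disjoint, Finset.sdiff_union_self_eq_union,
          Finset.sdiff_union_self_eq_union, Finset.union_comm]
      rw [e, ← sub_mul]
      refine Dvd.dvd.mul_right ?_ _
      have := Polynomial.sub_dvd_eval_sub u v (∏ b ∈ B, (Polynomial.X - Polynomial.C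
        (C b * X none : MvPolynomial (Option (Fin ℓ)) K)))
      simpa [Polynomial.eval_prod] using this)
  have hχ := planeDerivation_mem hG hjk hA hB (g := (u - v) * Q₁) (h := (u - v) * Q₂)
    (dvd_sub ((dvd_mul_right _ _).mul_left _) ((dvd_mul_right _ _).mul_left _))
  have : Module.Free (MvPolynomial (Option (Fin ℓ)) K)
    (logDerivations (cone (deletedIsh K ℓ G))) := hfree
  obtain ⟨α, β, hαβ⟩ := exists_eq_smul_add_smul_of_free (R := MvPolynomial (Option (Fin ℓ)) K)
    (M := logDerivations (cone (deletedIsh K ℓ G)))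
    (rootForm_regular (j := j) (k := k) (A \ B).card)
    (φ := ⟨_, hφ⟩) (ψ := ⟨_, hψ⟩) (χ := ⟨_, hχ⟩) (by
      refine Subtype.ext (derivation_ext_rootForm ?_ ?_ fun i => ?_)
      · simp [planeDerivation]
      · simp [planeDerivation]
      · simp only [Submodule.coe_sub, Submodule.coe_smul, Derivation.coe_sub, Pi.sub_apply,
          Derivation.smul_apply, smul_eq_mul]
        rcases eq_or_ne i j with rfl | hij
        · simp only [planeDerivation_fst]
          rw [← hu]
          linear_combination (crossProduct K i k * (∏ a ∈ A, (u - C a * X none)) * (u - v)) *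
            (hpow + hQ₁)
        rcases eq_or_ne i k with rfl | hik
        · simp only [planeDerivation_snd hjk]
          rw [← hu, ← hv]
          linear_combination (crossProduct K j i * (∏ b ∈ B, (v - C b * X none)) * (u - v)) *
            hQ₂
        · simp only [planeDerivation_of_ne hij hik]
          ring)
  exact ⟨_, α, α.2, β, β.2, congrArg Subtype.val hαβ⟩

theorem ishTuple_subset_of_isFreeArrangement {G : Set (Fin ℓ × Fin ℓ)}
    (hG : G ⊆ completeEdges ℓ) (hfree : IsFreeArrangement (cone (deletedIsh K ℓ G)))
    {j k : NonfirstVertex ℓ} (hjk : j ≠ k) {A B : Finset K}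
    (hA : (A : Set K) = ishTuple K ℓ G j) (hB : (B : Set K) = ishTuple K ℓ G k)
    (hcard : A.card ≤ B.card) : A ⊆ B := by
  classical
  intro a ha
  by_contra hab
  obtain ⟨g, α, hα, β, hβ, h⟩ := exists_planeDerivation_eq hG hfree hjk hA hB hcard
  rw [mem_logDerivations_deletedIsh hG] at hα hβ
  have hz := DFunLike.congr_fun h (X none)
  have hk := DFunLike.congr_fun h (rootForm K k)
  simp only [planeDerivation_none, planeDerivation_snd hjk, Derivation.add_apply,
    Derivation.smul_apply, smul_eq_mul] at hz hk
  obtain ⟨c, hc⟩ := hα.1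
  obtain ⟨c', hc'⟩ := hβ.1
  have hj0 : j.1 ≠ 0 := j.2.ne'
  have hk0 : k.1 ≠ 0 := k.2.ne'
  have hjk' : j.1 ≠ k.1 := fun h => hjk (Subtype.ext h)
  have hzne : (X none : MvPolynomial (Option (Fin ℓ)) K) ≠ 0 := X_ne_zero _
  have hvne : rootForm K k ≠ 0 := by
    simpa [rootForm] using (irreducible_sub_sub k.2.ne (0 : K)).ne_zero
  have huv : rootForm K j - rootForm K k ≠ 0 := by
    simpa [rootForm] using (irreducible_sub_sub hjk'.symm (0 : K)).ne_zero
  -- The plane derivation kills z. Hence z divides c, and the Euler correction disappears modulo z.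
  have hcc : (rootForm K j - rootForm K k) * c + X none * c' = 0 := by
    rw [hc, hc'] at hz
    refine (mul_eq_zero.1 (?_ : X none * _ = 0)).resolve_left hzne
    linear_combination -hz
  -- the quotient of the Euler-corrected coefficient at `x_1 - x_k`
  obtain ⟨T, hT⟩ : ∏ b ∈ B, (rootForm K k - C b * X none) ∣
      α (rootForm K k) - c * rootForm K k := by
    have := prod_rootForm_sub_dvd k (B.map ⟨Sum.inl, Sum.inl_injective⟩) (by simp)
      (p := α (rootForm K k) - c * rootForm K k) (by
        intro s hs
        obtain ⟨b, hb, rfl⟩ := Finset.mem_map.1 hs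
        have hb' : b ∈ ishTuple K ℓ G k := hB ▸ Finset.mem_coe.2 hb
        have h1 := hα.2.1 k b hb'
        rw [derivation_sub_C_mul, hc] at h1
        have h2 := dvd_sub h1 (dvd_mul_left (rootForm K k - C b * X none) c)
        refine h2.trans (dvd_of_eq ?_)
        ring)
    simpa only [Finset.prod_map, Function.Embedding.coeFn_mk, rootValue_inl] using this
  -- restriction to the hyperplane `z = 0`
  let Z : MvPolynomial (Option (Fin ℓ)) K →ₐ[K] MvPolynomial (Option (Fin ℓ)) K :=
    aeval fun o => if o = none then 0 else X o
  have hZz : Z (X none) = 0 := by simp [Z]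
  have hZr : ∀ i, Z (rootForm K i) = rootForm K i := by simp [Z, rootForm]
  have hZC : ∀ b, Z (C b) = C b := fun b => by simp [Z]
  have hZc : Z c = 0 := by
    have := congrArg Z hcc
    simp only [map_add, map_mul, map_sub, hZz, hZr, zero_mul, add_zero, map_zero] at this
    exact (mul_eq_zero.1 this).resolve_left huv
  have hZT : Z T = Z (crossProduct K j k) := by
    have h1 := congrArg Z hT
    have h2 := congrArg Z hk
    simp only [map_add, map_mul, map_sub, map_prod, hZz, hZr, hZc, mul_zero, zero_mul, add_zero,
      sub_zero, Finset.prod_const] at h1 h2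
    rw [h1] at h2
    refine mul_left_cancel₀ (mul_ne_zero huv (pow_ne_zero B.card hvne)) ?_
    linear_combination -h2
  -- restriction to the line on which `x_1 - x_j = x_1 - x_k = a z`
  let L : MvPolynomial (Option (Fin ℓ)) K →ₐ[K] Polynomial K :=
    aeval fun o => o.elim Polynomial.X fun i =>
      if i = j.1 ∨ i = k.1 then -(Polynomial.C a * Polynomial.X) else if i = 0 then 0 else 1
  have hLz : L (X none) = Polynomial.X := by simp [L]
  have hLj : L (rootForm K j) = Polynomial.C a * Polynomial.X := by
    simp [L, rootForm, hj0.symm, hk0.symm]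
  have hLk : L (rootForm K k) = Polynomial.C a * Polynomial.X := by
    simp [L, rootForm, hj0.symm, hk0.symm]
  have hLC : ∀ b, L (C b) = Polynomial.C b := fun b => by
    simp [L, Polynomial.algebraMap_eq]
  have hLT : L T = 0 := by
    obtain ⟨q₁, hq₁⟩ := hα.2.1 j a (hA ▸ Finset.mem_coe.2 ha)
    obtain ⟨q₂, hq₂⟩ := hα.2.2 j k hjk
    rw [derivation_sub_C_mul, hc] at hq₁
    rw [map_sub] at hq₂
    have h1 := congrArg L hq₁
    have h2 := congrArg L hq₂
    have h3 := congrArg L hT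
    simp only [map_mul, map_sub, map_prod, hLz, hLj, hLk, hLC, sub_self, zero_mul] at h1 h2 h3
    -- On the line, α(u) = az·c by the hyperplane u = az, and α(u) = α(v) by u = v; so α(v) - c·v
    -- vanishes there.
    have h4 : (∏ b ∈ B, (Polynomial.C a * Polynomial.X - Polynomial.C b * Polynomial.X)) *
        L T = 0 := by
      rw [← h3]
      linear_combination h1 - h2
    refine (mul_eq_zero.1 h4).resolve_left (Finset.prod_ne_zero_iff.2 fun b hb => ?_)
    rw [← sub_mul, ← Polynomial.C_sub]
    refine mul_ne_zero (Polynomial.C_ne_zero.2 (sub_ne_zero.2 ?_)) Polynomial.X_ne_zero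
    rintro rfl
    exact hab hb
  -- evaluation at a generic point of the flat `x_1 = x_j = x_k`, `z = 0`
  let ε : MvPolynomial (Option (Fin ℓ)) K →ₐ[K] K :=
    aeval fun o => o.elim 0 fun i => if i = j.1 ∨ i = k.1 then 0 else if i = 0 then 0 else 1
  have hεL : ε = (Polynomial.aeval (0 : K)).comp L := by
    apply algHom_ext
    rintro (_ | i)
    · simp [ε, L]
    · simp only [ε, L, aeval_X, AlgHom.comp_apply, Option.elim]
      split_ifs <;> simp
  have hεZ : ε.comp Z = ε := by
    apply algHom_ext
    rintro (_ | i) <;> simp [ε, Z]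
  have h0 : ε T = 0 := by rw [hεL, AlgHom.comp_apply, hLT, map_zero]
  have h1 : ε (crossProduct K j k) ≠ 0 := by
    rw [crossProduct, map_prod]
    refine Finset.prod_ne_zero_iff.2 fun i hi => ?_
    obtain ⟨-, hij, hik⟩ := Finset.mem_filter.1 hi
    have hij' : i.1 ≠ j.1 := fun h => hij (Subtype.ext h)
    have hik' : i.1 ≠ k.1 := fun h => hik (Subtype.ext h)
    have hi0 : i.1 ≠ 0 := i.2.ne'
    simp [ε, rootForm, hij', hik', hi0]
  -- The point lies on z = 0 and on the line, so there T equals `crossProduct` and is also zero.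
  apply h1
  rw [← hεZ, AlgHom.comp_apply, ← hZT, ← AlgHom.comp_apply, hεZ, h0]

lemma pairwiseInclusion_of_isFreeArrangement [CharZero K] {G : Set (Fin ℓ × Fin ℓ)}
    (hG : G ⊆ completeEdges ℓ) (hfree : IsFreeArrangement (cone (deletedIsh K ℓ G))) :
    PairwiseInclusion G := by
  intro j k
  rcases eq_or_ne j k with rfl | hjk
  · exact Or.inl fun _ => id
  rw [← ishTuple_subset_iff K, ← ishTuple_subset_iff K]
  have hj := (finite_ishTuple K G j).coe_toFinset
  have hk := (finite_ishTuple K G k).coe_toFinset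
  rw [← hj, ← hk, Finset.coe_subset, Finset.coe_subset]
  exact (le_total _ _).imp (ishTuple_subset_of_isFreeArrangement hG hfree hjk hj hk)
    (ishTuple_subset_of_isFreeArrangement hG hfree hjk.symm hk hj)

end FreeNest

end DeletedIsh

theorem theorem5p2 {K : Type*} [Field K] [CharZero K] (ℓ : ℕ) [NeZero ℓ]
    (G : Set (Fin ℓ × Fin ℓ)) (hG : G ⊆ DeletedIsh.completeEdges ℓ) :
    List.TFAE [
      DeletedIsh.IsFreeArrangement (DeletedIsh.cone (DeletedIsh.deletedIsh K ℓ G)),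
      DeletedIsh.IsNest (DeletedIsh.ishTuple K ℓ G),
      DeletedIsh.AthanasiadisCondition G,
      DeletedIsh.PairwiseInclusion G] := by
  tfae_have 1 → 4 := DeletedIsh.pairwiseInclusion_of_isFreeArrangement hG
  tfae_have 2 → 1 := DeletedIsh.isFreeArrangement_of_isNest hG
  tfae_have 2 ↔ 4 := DeletedIsh.isNest_iff_pairwiseInclusion K G
  tfae_have 3 ↔ 4 := DeletedIsh.athanasiadisCondition_iff_pairwiseInclusion hG
  tfae_finish
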